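/- **Definitions.** Let $x^1,x^2\in\mathbb R^2$ be linearly independent, $x^3=x^1+x^2$ and $X^-=\{x^1,x^2,-x^3\}$, and let $\alpha=(\alpha_1,\alpha_2,\alpha_3)$ with all $\alpha_j>0$ and $|\alpha|:=\alpha_1+\alpha_2+\alpha_3$. The fractional hex spline $B_\alpha(\cdot\,|\,X^-)$ of order $\alpha$ is the tempered distribution on $\mathbb R^2$ whose Fourier transform (in the convention $\widehat g(\omega)=\int_{\mathbb R^2} g(x)e^{-i\langle\omega,x\rangle}\,dx$) is the bounded function $$\widehat{B_\alpha}(\omega\,|\,X^-)=\left(\frac{1-e^{-i\langle\omega,x^1\rangle}}{i\langle\omega,x^1\rangle}\right)^{\alpha_1}\left(\frac{1-e^{-i\langle\omega,x^2\rangle}}{i\langle\omega,x^2\rangle}\right)^{\alpha_2}\left(\frac{e^{i\langle\omega,x^3\rangle}-1}{i\langle\omega,x^3\rangle}\right)^{\alpha_3},$$ with principal powers, where each quotient is read as $1$ if its denominator vanishes. If $B_\alpha(\cdot\,|\,X^-)\in L^2(\mathbb R^2)$, let $$\mathcal S^\alpha=\Big\{f\in L^2(\mathbb R^2)\ :\ \exists\,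 a\in\ell^2(\mathbb Z^2),\ f=\sum_{k\in\mathbb Z^2}a(k)\,B_\alpha(\cdot-k\,|\,X^-)\Big\},$$ the series converging unconditionally in $L^2(\mathbb R^2)$ (complex-valued functions and coefficients). A family $(f_k)$ in a Hilbert space is a Riesz basis of a subspace $S$ if its closed linear span is $S$ and there are constants $0<c\le C<\infty$ with $c\sum_k|a_k|^2\le\|\sum_k a_kf_k\|^2\le C\sum_k|a_k|^2$ for all finitely supported $(a_k)$. **Theorem.** Suppose that 1. $|x^j_1|+|x^j_2|\le\vartheta_j<2$ for $j=1,2,3$ (for $j=3$ this holds in particular if $x^3=(1,0)^T$); 2. $x^j_1\neq0$ and $x^j_2/x^j_1\notin\mathbb Q$ for $j=1,2$; 3. $|\alpha|>1$, and $\alpha_i+\alpha_j>\tfrac12$ for all $i\ne j$ in $\{1,2,3\}$. Then $B_\alpha(\cdot\,|\,X^-)\in L^2(\mathbb R^2)$, and the family $\{B_\alpha(\cdot-k\,|\,X^-)\ :\ k\in\mathbb Z^2\}$ of its integer translates is a Riesz basis of $\mathcal S^\alpha$. -/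

import Mathlib

open MeasureTheory FourierTransform
open scoped SchwartzMap ENNReal

noncomputable section

/-- The Euclidean plane `ℝ²`. -/
abbrev Plane : Type := EuclideanSpace ℝ (Fin 2)

/-- The space `L²(ℝ²)` of (classes of) complex-valued square-integrable functions. -/
abbrev PlaneL2 : Type := Lp ℂ 2 (volume : Measure Plane)

/-- The quotient `(1 - e^{-is}) / (is)`, with its continuous value `1` at `s = 0`. -/
def bsplineFactor (s : ℝ) : ℂ :=
  if s = 0 then 1 else
    (1 - Complex.exp (-(Complex.I * (s : ℂ)))) / (Complex.I * (s : ℂ))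

/-- The knot set `X⁻ = {x¹, x², -x³}` with `x³ = x¹ + x²`. -/
def hexKnots (x₁ x₂ : Plane) : Fin 3 → Plane := ![x₁, x₂, -(x₁ + x₂)]

/-- The Fourier transform `B̂_α(ω | X⁻)`, in the angular-frequency convention
`ĝ(ω) = ∫ g(x) e^{-i⟨ω,x⟩} dx`. The powers are principal; the factor that belongs to the knot
`-x³` is `(1 - e^{i⟨ω,x³⟩}) / (-i⟨ω,x³⟩) = (e^{i⟨ω,x³⟩} - 1) / (i⟨ω,x³⟩)`. -/
def hexSplineHat (x₁ x₂ : Plane) (α : Fin 3 → ℝ) (ω : Plane) : ℂ :=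
  ∏ j, bsplineFactor (inner ℝ ω (hexKnots x₁ x₂ j)) ^ (α j : ℂ)

theorem measurable_bsplineFactor : Measurable bsplineFactor := by
  unfold bsplineFactor
  exact Measurable.ite (measurableSet_singleton (0 : ℝ)) measurable_const (by fun_prop)

theorem norm_bsplineFactor_le_one (s : ℝ) : ‖bsplineFactor s‖ ≤ 1 := by
  unfold bsplineFactor
  split_ifs with h
  · simp
  · have hs : (0 : ℝ) < |s| := abs_pos.mpr h
    have h1 : ‖(1 : ℂ) - Complex.exp (-(Complex.I * (s : ℂ)))‖ ≤ |s| := by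
      have h2 := Real.norm_exp_I_mul_ofReal_sub_one_le (x := -s)
      rw [norm_sub_rev]
      simpa using h2
    rw [norm_div, norm_mul, Complex.norm_I, one_mul, Complex.norm_real, Real.norm_eq_abs]
    exact (div_le_one hs).mpr h1

theorem measurable_hexSplineHat (x₁ x₂ : Plane) (α : Fin 3 → ℝ) :
    Measurable (hexSplineHat x₁ x₂ α) := by
  unfold hexSplineHat
  refine Finset.measurable_prod _ fun j _ => ?_
  refine Measurable.pow_const (measurable_bsplineFactor.comp ?_) _
  fun_prop

theorem norm_hexSplineHat_le_one (x₁ x₂ : Plane) {α : Fin 3 → ℝ} (hα : ∀ j, 0 < α j)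
    (ω : Plane) : ‖hexSplineHat x₁ x₂ α ω‖ ≤ 1 := by
  unfold hexSplineHat
  rw [norm_prod]
  refine Finset.prod_le_one (fun _ _ => norm_nonneg _) fun j _ => ?_
  rw [Complex.norm_cpow_real]
  exact Real.rpow_le_one (norm_nonneg _) (norm_bsplineFactor_le_one _) (hα j).le

/-- The function `ξ ↦ B̂_α(2πξ | X⁻)` is bounded. -/
theorem memLp_hexSplineHat (x₁ x₂ : Plane) {α : Fin 3 → ℝ} (hα : ∀ j, 0 < α j) :
    MemLp (fun ξ : Plane => hexSplineHat x₁ x₂ α ((2 * Real.pi) • ξ)) ∞ volume :=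
  memLp_top_of_bound
    ((measurable_hexSplineHat x₁ x₂ α).comp (measurable_const_smul _)).aestronglyMeasurable 1
    (Filter.Eventually.of_forall fun _ => norm_hexSplineHat_le_one x₁ x₂ hα _)

/-- The fractional hex spline `B_α(· | X⁻)`, `α ∈ ℝ₊³`: the tempered distribution whose Fourier
transform is the bounded function `B̂_α(· | X⁻)`. Mathlib's Fourier transform has the kernel
`e^{-2πi⟨ξ,x⟩}`, so that it is the function `ξ ↦ B̂_α(2πξ | X⁻)` in that convention. -/
def hexSpline (x₁ x₂ : Plane) (α : Fin 3 → ℝ) (hα : ∀ j, 0 < α j) : 𝓢'(Plane, ℂ) :=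
  𝓕⁻ (Lp.toTemperedDistribution (memLp_hexSplineHat x₁ x₂ hα).toLp)

/-- The point of the lattice `ℤ² ⊂ ℝ²` with coordinates `k`. -/
def latticePoint (k : Fin 2 → ℤ) : Plane := WithLp.toLp 2 fun i => (k i : ℝ)

/-- The translate `φ(· - k)`, `k ∈ ℤ²`, of `φ ∈ L²(ℝ²)`. -/
def latticeTranslate (φ : PlaneL2) (k : Fin 2 → ℤ) : PlaneL2 :=
  Lp.compMeasurePreserving (fun x : Plane => x - latticePoint k)
    (measurePreserving_sub_right volume (latticePoint k)) φ

/-- The space of all `f ∈ L²(ℝ²)` of the form `f = ∑_{k ∈ ℤ²} a(k) φ(· - k)` with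
`a ∈ ℓ²(ℤ²)`, the series converging (unconditionally) in `L²(ℝ²)`. -/
def shiftSpace (φ : PlaneL2) : Submodule ℂ PlaneL2 where
  carrier := {f | ∃ a : lp (fun _ : Fin 2 → ℤ => ℂ) 2,
    HasSum (fun k => a k • latticeTranslate φ k) f}
  zero_mem' := ⟨0, by simp⟩
  add_mem' := by
    rintro f g ⟨a, ha⟩ ⟨b, hb⟩
    exact ⟨a + b, by simpa [add_smul] using ha.add hb⟩
  smul_mem' := by
    rintro c f ⟨a, ha⟩
    exact ⟨c • a, by simpa [smul_smul] using ha.const_smul c⟩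

/-- The family `f` is a Riesz basis of the subspace `S` of the Hilbert space `H`: its closed
linear span is `S`, and `c ∑ |aᵢ|² ≤ ‖∑ aᵢ fᵢ‖² ≤ C ∑ |aᵢ|²` for all finite families `a` of
coefficients, with constants `0 < c` and `C` that do not depend on `a`. -/
def IsRieszBasis {ι H : Type*} [NormedAddCommGroup H] [InnerProductSpace ℂ H]
    (f : ι → H) (S : Submodule ℂ H) : Prop :=
  (Submodule.span ℂ (Set.range f)).topologicalClosure = S ∧
    ∃ c C : ℝ, 0 < c ∧ 0 < C ∧ ∀ (s : Finset ι) (a : ι → ℂ),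
      c * ∑ i ∈ s, ‖a i‖ ^ 2 ≤ ‖∑ i ∈ s, a i • f i‖ ^ 2 ∧
        ‖∑ i ∈ s, a i • f i‖ ^ 2 ≤ C * ∑ i ∈ s, ‖a i‖ ^ 2

end

/-!
Write `G(ξ) = B̂_α(2πξ)`. Once `G` is square integrable, `B = 𝓕⁻ G` is the hex spline as an `L²`
function, and since translation by `k` becomes multiplication by `e^{-2πi⟨k,ξ⟩}`
(`fourier_latticeTranslate`), Plancherel's theorem gives
`‖∑ a(k) B(· - k)‖² = ∫ |A(ξ)|² |G(ξ)|² dξ` for the trigonometric polynomial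
`A(ξ) = ∑ a(k) e^{-2πi⟨k,ξ⟩}`. By Parseval's identity (`lintegral_unitCell_enorm_sq`) the integral
of `|A|²` over each cell `m + (-1/2, 1/2]²` is `∑ |a(k)|²`, so only two facts about `G` are needed.

* Lower bound: on the central cell `|⟨ξ, xʲ⟩| ≤ (|xʲ₁| + |xʲ₂|) / 2 < 1`, whereas the factors of `G`
  vanish only where `⟨ξ, xʲ⟩` is a nonzero integer; by compactness `|G|² ≥ c > 0` on that cell
  (`exists_pos_le_norm_hexSplineHat_sq`).
* Upper bound: on the cell of `m`, `|G|²` is at most a constant times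
  `∏ (1 + |⟨m, xʲ⟩|)^(-2αⱼ)` (`norm_hexSplineHat_sq_le`), and the sum of these weights over `ℤ²` is
  finite (`summable_prod_linearForm_rpow`). As `x³ = x¹ + x²`, the two larger of the numbers
  `|⟨m, xʲ⟩|` are comparable. The decay in the larger ones has an exponent `2(αᵢ + αⱼ) > 1`, and
  since the exponents add up to `2|α| > 2`, it can be redistributed so that two of the three factors
  have a common exponent `σ > 1` (`rpow_mul_rpow_mul_rpow_le`). The resulting series are comparable
  with products of one-dimensional ones (`summable_linearForms_rpow`).

The second fact also gives `G ∈ L²` (`memLp_two_of_unitCell_bound`). Finally, the two Riesz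
inequalities make the synthesis operator `ℓ² → L²` bounded with closed range, so that the closed
span of the translates is the space of all sums `∑ a(k) B(· - k)` with `a ∈ ℓ²`
(`exists_lp_hasSum_iff_mem_closure_span`).
-/

/-! ### Riesz sequences and the synthesis operator -/

section RieszSequence

variable {ι H : Type*} [NormedAddCommGroup H] [InnerProductSpace ℂ H]

/-- The upper Riesz inequality makes `∑ aᵢ fᵢ` a Cauchy series for every square-summable `a`. -/
theorem summable_smul_of_upper_riesz_bound [CompleteSpace H] {f : ι → H} {C : ℝ} (hC : 0 < C)
    (hup : ∀ (s : Finset ι) (a : ι → ℂ),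
      ‖∑ i ∈ s, a i • f i‖ ^ 2 ≤ C * ∑ i ∈ s, ‖a i‖ ^ 2)
    {a : ι → ℂ} (ha : Summable fun i => ‖a i‖ ^ 2) : Summable fun i => a i • f i := by
  rw [summable_iff_vanishing_norm] at ha ⊢
  intro ε hε
  obtain ⟨s, hs⟩ := ha (ε ^ 2 / C) (by positivity)
  refine ⟨s, fun t ht => ?_⟩
  have h1 := hs t ht
  rw [Real.norm_of_nonneg (Finset.sum_nonneg fun _ _ => by positivity), lt_div_iff₀ hC] at h1
  have h2 := hup t a
  exact lt_of_pow_lt_pow_left₀ 2 hε.le (by linarith)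

/-- If the finite combinations of `f` satisfy the two Riesz inequalities, the synthesis operator
`a ↦ ∑ aᵢ fᵢ` on `ℓ²` is bounded and bounded below, so that its range is closed. The range is
therefore the closed linear span of `f`. -/
theorem exists_lp_hasSum_iff_mem_closure_span [CompleteSpace H] {f : ι → H} {c C : ℝ}
    (hc : 0 < c) (hC : 0 < C)
    (hlow : ∀ (s : Finset ι) (a : ι → ℂ),
      c * ∑ i ∈ s, ‖a i‖ ^ 2 ≤ ‖∑ i ∈ s, a i • f i‖ ^ 2)
    (hup : ∀ (s : Finset ι) (a : ι → ℂ),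
      ‖∑ i ∈ s, a i • f i‖ ^ 2 ≤ C * ∑ i ∈ s, ‖a i‖ ^ 2) (x : H) :
    (∃ a : lp (fun _ : ι => ℂ) 2, HasSum (fun i => a i • f i) x) ↔
      x ∈ (Submodule.span ℂ (Set.range f)).topologicalClosure := by
  have hsq (a : lp (fun _ : ι => ℂ) 2) : HasSum (fun i => ‖a i‖ ^ 2) (‖a‖ ^ 2) := by
    simpa using lp.hasSum_norm (p := 2) (by norm_num) a
  have hsum (a : lp (fun _ : ι => ℂ) 2) : Summable fun i => a i • f i :=
    summable_smul_of_upper_riesz_bound hC hup (hsq a).summable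
  have hnorm (a : lp (fun _ : ι => ℂ) 2) :
      Filter.Tendsto (fun s : Finset ι => ‖∑ i ∈ s, a i • f i‖ ^ 2) Filter.atTop
        (nhds (‖∑' i, a i • f i‖ ^ 2)) := (hsum a).hasSum.norm.pow 2
  have hlim (K : ℝ) (a : lp (fun _ : ι => ℂ) 2) :
      Filter.Tendsto (fun s : Finset ι => K * ∑ i ∈ s, ‖a i‖ ^ 2) Filter.atTop
        (nhds (K * ‖a‖ ^ 2)) := Filter.Tendsto.const_mul K (hsq a)
  have hup' (a : lp (fun _ : ι => ℂ) 2) : ‖∑' i, a i • f i‖ ^ 2 ≤ C * ‖a‖ ^ 2 :=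
    le_of_tendsto_of_tendsto' (hnorm a) (hlim C a) fun s => hup s _
  have hlow' (a : lp (fun _ : ι => ℂ) 2) : c * ‖a‖ ^ 2 ≤ ‖∑' i, a i • f i‖ ^ 2 :=
    le_of_tendsto_of_tendsto' (hlim c a) (hnorm a) fun s => hlow s _
  let T₀ : lp (fun _ : ι => ℂ) 2 →ₗ[ℂ] H :=
    { toFun := fun a => ∑' i, a i • f i
      map_add' := fun a b => by
        simpa [add_smul] using ((hsum a).tsum_add (hsum b))
      map_smul' := fun r a => by
        simpa [smul_smul] using ((hsum a).tsum_const_smul r) }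
  let T : lp (fun _ : ι => ℂ) 2 →L[ℂ] H := T₀.mkContinuous (√C) fun a => by
    refine le_of_sq_le_sq ?_ (by positivity)
    rw [mul_pow, Real.sq_sqrt hC.le]
    exact hup' a
  have hanti : AntilipschitzWith (Real.toNNReal (√c)⁻¹) T := by
    refine AddMonoidHomClass.antilipschitz_of_bound T fun a => ?_
    rw [Real.coe_toNNReal _ (by positivity), inv_mul_eq_div, le_div_iff₀ (by positivity)]
    refine le_of_sq_le_sq ?_ (norm_nonneg _)
    rw [mul_pow, Real.sq_sqrt hc.le, mul_comm]
    exact hlow' a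
  have hclosed : IsClosed (Set.range T) := hanti.isClosed_range T.uniformContinuous
  constructor
  · rintro ⟨a, ha⟩
    refine (Submodule.isClosed_topologicalClosure _).mem_of_tendsto ha
      (Filter.Eventually.of_forall fun s => Submodule.sum_mem _ fun i _ => ?_)
    exact Submodule.smul_mem _ _
      (Submodule.le_topologicalClosure _ (Submodule.subset_span ⟨i, rfl⟩))
  · intro hx
    have hle : (Submodule.span ℂ (Set.range f)).topologicalClosure ≤ T₀.range := by
      refine Submodule.topologicalClosure_minimal _ (Submodule.span_le.2 ?_) hclosed
      rintro _ ⟨i, rfl⟩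
      classical
      refine ⟨lp.single 2 i 1, ?_⟩
      change ∑' j, (lp.single 2 i (1 : ℂ) : lp (fun _ : ι => ℂ) 2) j • f j = f i
      rw [tsum_eq_single i]
      · simp
      · intro j hj
        simp [hj]
    obtain ⟨a, rfl⟩ := hle hx
    exact ⟨a, (hsum a).hasSum⟩

end RieszSequence

/-! ### Translation and modulation on `L²(ℝ²)` -/

/-- The character `ξ ↦ e^{2πi⟨k,ξ⟩}` of the plane. -/
noncomputable def latticeChar (k : Fin 2 → ℤ) (ξ : Plane) : ℂ :=
  UnitAddTorus.mFourier k fun i => (ξ i : UnitAddCircle)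

theorem latticeChar_neg_eq (k : Fin 2 → ℤ) (ξ : Plane) :
    latticeChar (-k) ξ = Real.fourierChar (-inner ℝ (latticePoint k) ξ) := by
  simp only [latticeChar, UnitAddTorus.mFourier, ContinuousMap.coe_mk, Fin.prod_univ_two,
    fourier_coe_apply, ← Complex.exp_add, Real.fourierChar_apply, PiLp.inner_apply,
    Fin.sum_univ_two, latticePoint]
  congr 1
  simp
  ring

theorem norm_latticeChar (k : Fin 2 → ℤ) (ξ : Plane) : ‖latticeChar k ξ‖ = 1 := by
  simp only [latticeChar, UnitAddTorus.mFourier, ContinuousMap.coe_mk, norm_prod, fourier_apply,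
    Circle.norm_coe, Finset.prod_const_one]

theorem continuous_latticeChar (k : Fin 2 → ℤ) : Continuous (latticeChar k) := by
  unfold latticeChar
  refine (UnitAddTorus.mFourier k).continuous.comp (continuous_pi fun i => ?_)
  exact (AddCircle.continuous_mk' 1).comp (by fun_prop)

theorem memLp_latticeChar (k : Fin 2 → ℤ) : MemLp (latticeChar k) ∞ volume :=
  memLp_top_of_bound (continuous_latticeChar k).aestronglyMeasurable 1
    (Filter.Eventually.of_forall fun ξ => (norm_latticeChar k ξ).le)

/-- Multiplication by a character of the plane, as a bounded operator on `L²(ℝ²)`. -/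
noncomputable def modulation (k : Fin 2 → ℤ) : PlaneL2 →L[ℂ] PlaneL2 :=
  (ContinuousLinearMap.mul ℂ ℂ).holderL volume ∞ 2 2 (memLp_latticeChar k).toLp

theorem coeFn_modulation (k : Fin 2 → ℤ) (f : PlaneL2) :
    modulation k f =ᵐ[volume] fun ξ => latticeChar k ξ * f ξ := by
  have h := (ContinuousLinearMap.mul ℂ ℂ).coeFn_holder (r := 2) (memLp_latticeChar k).toLp f
  filter_upwards [h, (memLp_latticeChar k).coeFn_toLp] with ξ h1 h2
  rw [← h2]
  exact h1

theorem fourier_compSubConstCLM (φ : 𝓢(Plane, ℂ)) (k : Fin 2 → ℤ) (ξ : Plane) :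
    𝓕 (φ.compSubConstCLM ℂ (latticePoint k)) ξ = latticeChar (-k) ξ * 𝓕 φ ξ := by
  have h := congrFun (VectorFourier.fourierIntegral_comp_add_right Real.fourierChar volume
    (innerₗ Plane) φ (-latticePoint k)) ξ
  rw [latticeChar_neg_eq]
  simp only [SchwartzMap.fourier_coe]
  simpa [Circle.smul_def, sub_eq_add_neg, Function.comp_def] using! h

/-- The Fourier transform on `L²(ℝ²)` turns translation by `k` into multiplication by
`e^{-2πi⟨k,ξ⟩}`; both sides are continuous, so it is enough to look at Schwartz functions. -/
theorem fourier_latticeTranslate (f : PlaneL2) (k : Fin 2 → ℤ) :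
    𝓕 (latticeTranslate f k) = modulation (-k) (𝓕 f) := by
  refine DenseRange.induction_on
    (p := fun f : PlaneL2 => 𝓕 (latticeTranslate f k) = modulation (-k) (𝓕 f))
    (SchwartzMap.denseRange_toLpCLM (F := ℂ) (p := 2) (μ := (volume : Measure Plane))
      ENNReal.ofNat_ne_top) f ?_ ?_
  · refine isClosed_eq ?_ ?_
    · exact (Lp.fourierTransformₗᵢ Plane ℂ).continuous.comp
        (Lp.isometry_compMeasurePreserving _).continuous
    · exact (modulation (-k)).continuous.comp (Lp.fourierTransformₗᵢ Plane ℂ).continuous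
  · intro φ
    have h : latticeTranslate (φ.toLp 2) k = (φ.compSubConstCLM ℂ (latticePoint k)).toLp 2 := rfl
    simp only [SchwartzMap.toLpCLM_apply]
    rw [h, SchwartzMap.toLp_fourier_eq, SchwartzMap.toLp_fourier_eq]
    ext1
    filter_upwards [SchwartzMap.coeFn_toLp (𝓕 (φ.compSubConstCLM ℂ (latticePoint k))) 2,
      SchwartzMap.coeFn_toLp (𝓕 φ) 2, coeFn_modulation (-k) ((𝓕 φ).toLp 2)] with ξ h1 h2 h3
    rw [h1, h3, h2, fourier_compSubConstCLM]

/-! ### Parseval's identity on the cells of the lattice -/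

theorem enorm_sq_eq_lintegral {X E : Type*} [MeasurableSpace X] {μ : Measure X}
    [NormedAddCommGroup E] (f : Lp E 2 μ) : ‖f‖ₑ ^ 2 = ∫⁻ x, ‖f x‖ₑ ^ 2 ∂μ := by
  rw [Lp.enorm_def, eLpNorm_eq_lintegral_rpow_enorm_toReal (by norm_num) (by norm_num),
    ← ENNReal.rpow_natCast, ← ENNReal.rpow_mul]
  simp

theorem coeFn_sum_smul_ae_eq {X ι : Type*} [MeasurableSpace X] {μ : Measure X} (s : Finset ι)
    (a : ι → ℂ) (f : ι → Lp ℂ 2 μ) {g : ι → X → ℂ} (hfg : ∀ i, f i =ᵐ[μ] g i) :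
    ⇑(∑ i ∈ s, a i • f i) =ᵐ[μ] fun x => ∑ i ∈ s, a i * g i x := by
  classical
  induction s using Finset.induction_on with
  | empty => simpa [Pi.zero_def] using! Lp.coeFn_zero ℂ 2 μ
  | insert i s hi ih =>
    rw [Finset.sum_insert hi]
    filter_upwards [Lp.coeFn_add (a i • f i) (∑ i ∈ s, a i • f i), Lp.coeFn_smul (a i) (f i),
      ih, hfg i] with x h1 h2 h3 h4
    rw [h1, Pi.add_apply, h2, h3, Finset.sum_insert hi, Pi.smul_apply, h4, smul_eq_mul]

/-- The cell `m + (-1/2, 1/2]²`. -/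
noncomputable def unitCell (m : Fin 2 → ℤ) : Set Plane :=
  {ξ | ∀ i, ξ i ∈ Set.Ioc ((m i : ℝ) - 1 / 2) ((m i : ℝ) - 1 / 2 + 1)}

theorem iUnion_unitCell : ⋃ m, unitCell m = Set.univ := by
  refine Set.eq_univ_of_forall fun ξ => Set.mem_iUnion.2 ⟨fun i => ⌈ξ i - 1 / 2⌉, fun i => ?_⟩
  have h1 := Int.le_ceil (ξ i - 1 / 2)
  have h2 := Int.ceil_lt_add_one (ξ i - 1 / 2)
  constructor <;> linarith

theorem measurableSet_unitCell (m : Fin 2 → ℤ) : MeasurableSet (unitCell m) := by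
  simp only [unitCell, Set.ofPred_forall]
  exact MeasurableSet.iInter fun i => measurableSet_Ioc.preimage (by fun_prop)

/-- Parseval's identity for trigonometric polynomials, on any cell. -/
theorem lintegral_unitCell_enorm_sq (s : Finset (Fin 2 → ℤ)) (a : (Fin 2 → ℤ) → ℂ)
    (m : Fin 2 → ℤ) :
    ∫⁻ ξ in unitCell m, ‖∑ k ∈ s, a k * latticeChar (-k) ξ‖ₑ ^ 2 =
      ENNReal.ofReal (∑ k ∈ s, ‖a k‖ ^ 2) := by
  have hpre := UnitAddTorus.lintegral_preimage
    (fun z : UnitAddTorus (Fin 2) => ‖∑ k ∈ s, a k * UnitAddTorus.mFourier (-k) z‖ₑ ^ 2)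
    (fun i => (m i : ℝ) - 1 / 2)
  have hpreim : unitCell m = WithLp.ofLp ⁻¹'
      {x : Fin 2 → ℝ | ∀ i, x i ∈ Set.Ioc ((m i : ℝ) - 1 / 2) ((m i : ℝ) - 1 / 2 + 1)} := rfl
  have hcell : ∫⁻ ξ in unitCell m, ‖∑ k ∈ s, a k * latticeChar (-k) ξ‖ₑ ^ 2 =
      ∫⁻ x in {x : Fin 2 → ℝ | ∀ i, x i ∈ Set.Ioc ((m i : ℝ) - 1 / 2) ((m i : ℝ) - 1 / 2 + 1)},
        ‖∑ k ∈ s, a k * UnitAddTorus.mFourier (-k) (fun i => (x i : UnitAddCircle))‖ₑ ^ 2 := by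
    rw [hpreim]
    exact
    (PiLp.volume_preserving_ofLp (Fin 2)).setLIntegral_comp_preimage_emb
      (MeasurableEquiv.toLp 2 (Fin 2 → ℝ)).symm.measurableEmbedding
      (fun x => ‖∑ k ∈ s, a k * UnitAddTorus.mFourier (-k) (fun i => (x i : UnitAddCircle))‖ₑ ^ 2)
      _
  rw [hcell, ← hpre]
  have horth := (UnitAddTorus.orthonormal_mFourier (d := Fin 2)).comp
    (fun k : Fin 2 → ℤ => -k) neg_injective
  have hnorm : ‖∑ k ∈ s, a k • UnitAddTorus.mFourierLp (d := Fin 2) 2 (-k)‖ ^ 2 =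
      ∑ k ∈ s, ‖a k‖ ^ 2 := by
    have h := horth.inner_sum a a s
    rw [inner_self_eq_norm_sq_to_K] at h
    have h2 : ((‖∑ k ∈ s, a k • UnitAddTorus.mFourierLp (d := Fin 2) 2 (-k)‖ ^ 2 : ℝ) : ℂ) =
        ((∑ k ∈ s, ‖a k‖ ^ 2 : ℝ) : ℂ) := by
      push_cast
      refine Eq.trans h (Finset.sum_congr rfl fun k _ => ?_)
      exact Complex.conj_mul' (a k)
    exact_mod_cast h2
  have hL2 := enorm_sq_eq_lintegral (∑ k ∈ s, a k • UnitAddTorus.mFourierLp (d := Fin 2) 2 (-k))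
  rw [← hnorm, ENNReal.ofReal_pow (norm_nonneg _), ofReal_norm, hL2]
  refine lintegral_congr_ae ?_
  filter_upwards [coeFn_sum_smul_ae_eq s a _
    fun k => UnitAddTorus.coeFn_mFourierLp (d := Fin 2) 2 (-k)] with z hz
  rw [hz]

theorem continuous_sum_latticeChar (s : Finset (Fin 2 → ℤ)) (a : (Fin 2 → ℤ) → ℂ) :
    Continuous fun ξ => ∑ k ∈ s, a k * latticeChar (-k) ξ :=
  continuous_finsetSum _ fun _ _ => continuous_const.mul (continuous_latticeChar _)

/-- If `|G|²` is dominated on each cell by a term of a convergent series, then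
`∫ |A|² |G|² ≤ C ∑ |a(k)|²` for the trigonometric polynomial `A` with coefficients `a`. -/
theorem lintegral_enorm_sq_mul_le {G : Plane → ℂ} {W : (Fin 2 → ℤ) → ℝ≥0∞}
    (hW : ∀ m, ∀ ξ ∈ unitCell m, ‖G ξ‖ₑ ^ 2 ≤ W m) (s : Finset (Fin 2 → ℤ))
    (a : (Fin 2 → ℤ) → ℂ) :
    ∫⁻ ξ, ‖(∑ k ∈ s, a k * latticeChar (-k) ξ) * G ξ‖ₑ ^ 2 ≤
      (∑' m, W m) * ENNReal.ofReal (∑ k ∈ s, ‖a k‖ ^ 2) := by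
  rw [← setLIntegral_univ, ← iUnion_unitCell, ← ENNReal.tsum_mul_right]
  refine (lintegral_iUnion_le _ _).trans (ENNReal.tsum_le_tsum fun m => ?_)
  rw [← lintegral_unitCell_enorm_sq s a m, ← lintegral_const_mul]
  · refine setLIntegral_mono' (measurableSet_unitCell m) fun ξ hξ => ?_
    rw [enorm_mul, mul_pow, mul_comm]
    gcongr
    exact hW m ξ hξ
  · exact ((continuous_sum_latticeChar s a).enorm.measurable).pow_const 2

theorem le_lintegral_enorm_sq_mul {G : Plane → ℂ} {c : ℝ≥0∞}
    (hc : ∀ ξ ∈ unitCell 0, c ≤ ‖G ξ‖ₑ ^ 2) (s : Finset (Fin 2 → ℤ))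
    (a : (Fin 2 → ℤ) → ℂ) :
    c * ENNReal.ofReal (∑ k ∈ s, ‖a k‖ ^ 2) ≤
      ∫⁻ ξ, ‖(∑ k ∈ s, a k * latticeChar (-k) ξ) * G ξ‖ₑ ^ 2 := by
  rw [← lintegral_unitCell_enorm_sq s a 0, ← lintegral_const_mul]
  · refine (setLIntegral_mono' (measurableSet_unitCell 0) fun ξ hξ => ?_).trans
      (setLIntegral_le_lintegral (unitCell 0) _)
    rw [enorm_mul, mul_pow, mul_comm]
    gcongr
    exact hc ξ hξ
  · exact ((continuous_sum_latticeChar s a).enorm.measurable).pow_const 2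

/-- Plancherel's theorem for finite combinations of integer translates. -/
theorem norm_sum_latticeTranslate_eq {B : PlaneL2} {G : Plane → ℂ} (hBG : ⇑(𝓕 B : PlaneL2) =ᵐ[volume] G)
    (s : Finset (Fin 2 → ℤ)) (a : (Fin 2 → ℤ) → ℂ) :
    ENNReal.ofReal (‖∑ k ∈ s, a k • latticeTranslate B k‖ ^ 2) =
      ∫⁻ ξ, ‖(∑ k ∈ s, a k * latticeChar (-k) ξ) * G ξ‖ₑ ^ 2 := by
  have hF : 𝓕 (∑ k ∈ s, a k • latticeTranslate B k) =
      ∑ k ∈ s, a k • modulation (-k) (𝓕 B) := by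
    have h := map_sum (Lp.fourierTransformₗᵢ Plane ℂ) (fun k => a k • latticeTranslate B k) s
    refine Eq.trans h (Finset.sum_congr rfl fun k _ => ?_)
    rw [map_smul, ← fourier_latticeTranslate]
    rfl
  rw [← Lp.norm_fourier_eq, ENNReal.ofReal_pow (norm_nonneg _), ofReal_norm,
    enorm_sq_eq_lintegral, hF]
  refine lintegral_congr_ae ?_
  filter_upwards [coeFn_sum_smul_ae_eq s a _ fun k => coeFn_modulation (-k) (𝓕 B), hBG]
    with ξ h1 h2
  rw [h1, ← h2, Finset.sum_mul]
  simp only [mul_assoc]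

/-! ### Size of the B-spline factors and summability of the weight -/

theorem norm_bsplineFactor (s : ℝ) : ‖bsplineFactor s‖ = |Real.sinc (s / 2)| := by
  unfold bsplineFactor
  split_ifs with h
  · simp [h]
  · have h1 : ‖(1 : ℂ) - Complex.exp (-(Complex.I * (s : ℂ)))‖ = 2 * |Real.sin (s / 2)| := by
      have h2 := Complex.norm_exp_I_mul_ofReal_sub_one (-s)
      rw [norm_sub_rev]
      simpa [neg_div] using h2
    rw [norm_div, h1, norm_mul, Complex.norm_I, one_mul, Complex.norm_real, Real.norm_eq_abs,
      Real.sinc_of_ne_zero (by simpa using h), abs_div, abs_div, abs_two]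
    have : |s| ≠ 0 := abs_ne_zero.2 h
    field_simp

theorem norm_bsplineFactor_le (s : ℝ) : ‖bsplineFactor s‖ ≤ 3 / (1 + |s|) := by
  rw [le_div_iff₀ (by positivity)]
  have h1 := norm_bsplineFactor_le_one s
  have h2 : ‖bsplineFactor s‖ * |s| ≤ 2 := by
    rcases eq_or_ne s 0 with rfl | hs
    · simp
    · rw [norm_bsplineFactor, Real.sinc_of_ne_zero (by simpa using hs), abs_div, abs_div, abs_two]
      have : |s| ≠ 0 := abs_ne_zero.2 hs
      have h3 := Real.abs_sin_le_one (s / 2)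
      field_simp
      linarith
  linarith

/-- The zeros of the B-spline factor nearest to the origin are `±2π`. -/
theorem exists_pos_le_norm_bsplineFactor {r : ℝ} (hr : r < 2 * Real.pi) :
    ∃ c > 0, ∀ s, |s| ≤ r → c ≤ ‖bsplineFactor s‖ := by
  rcases lt_or_ge r 0 with h0 | h0
  · exact ⟨1, one_pos, fun s hs => absurd (abs_nonneg s) (by linarith)⟩
  have hcont : Continuous fun s => ‖bsplineFactor s‖ := by
    simp only [norm_bsplineFactor]
    exact (Real.continuous_sinc.comp (by fun_prop)).abs
  obtain ⟨s₀, hs₀, hmin⟩ := (isCompact_Icc (a := -r) (b := r)).exists_isMinOn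
    ⟨0, by simpa using h0⟩ hcont.continuousOn
  refine ⟨‖bsplineFactor s₀‖, ?_, fun s hs => hmin (abs_le.1 hs)⟩
  rw [norm_bsplineFactor, gt_iff_lt, abs_pos]
  rcases eq_or_ne s₀ 0 with rfl | hne
  · simp
  rw [Real.sinc_of_ne_zero (by simpa using hne)]
  refine div_ne_zero (fun hsin => ?_) (by simpa using hne)
  have := (Real.sin_eq_zero_iff_of_lt_of_lt (by linarith [hs₀.1]) (by linarith [hs₀.2])).1 hsin
  exact hne (by linarith)

theorem summable_int_one_add_abs_rpow {σ : ℝ} (hσ : 1 < σ) :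
    Summable fun n : ℤ => (1 + |(n : ℝ)|) ^ (-σ) := by
  have h : Summable fun n : ℕ => (1 + (n : ℝ)) ^ (-σ) := by
    have := (summable_nat_add_iff 1).2 (Real.summable_nat_rpow.2 (neg_lt_neg hσ))
    simpa [add_comm] using this
  exact Summable.of_nat_of_neg (by simpa using h) (by simpa using h)

/-- Two independent linear forms separate the points of `ℤ²` up to a fixed distance `δ`, so that
rounding them to multiples of `δ` embeds `ℤ²` into `ℤ²`; this compares the series with a product
of two one-dimensional ones. -/
theorem summable_linearForms_rpow {p q r t σ : ℝ} (hdet : p * t - q * r ≠ 0) (hσ : 1 < σ) :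
    Summable fun m : Fin 2 → ℤ =>
      (1 + |m 0 * p + m 1 * q|) ^ (-σ) * (1 + |m 0 * r + m 1 * t|) ^ (-σ) := by
  set D := p * t - q * r with hD
  set R := |p| + |q| + |r| + |t| with hR
  have hR0 : 0 ≤ R := by positivity
  have hD0 : 0 < |D| := abs_pos.2 hdet
  -- By Cramer's rule, two integer points whose images are less than `δ` apart in both forms differ
  -- by less than `1` in each coordinate.
  set δ := |D| / (R + 1) with hδ
  have hδ0 : 0 < δ := by positivity
  have hδR : δ * R < |D| := by
    rw [hδ, div_mul_eq_mul_div, div_lt_iff₀ (by positivity)]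
    nlinarith
  let φ : (Fin 2 → ℤ) → ℤ × ℤ := fun m =>
    (⌊((m 0 : ℝ) * p + m 1 * q) / δ⌋, ⌊((m 0 : ℝ) * r + m 1 * t) / δ⌋)
  have hzero (n : ℤ) (h : |(n : ℝ)| * |D| ≤ δ * R) : n = 0 := by
    have : |(n : ℝ)| < 1 := by
      by_contra hcon
      push Not at hcon
      nlinarith
    exact Int.abs_lt_one_iff.1 (by exact_mod_cast this)
  have hφ : Function.Injective φ := by
    intro m n hmn
    have h1 := Int.abs_sub_lt_one_of_floor_eq_floor (congrArg Prod.fst hmn)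
    have h2 := Int.abs_sub_lt_one_of_floor_eq_floor (congrArg Prod.snd hmn)
    rw [← sub_div, abs_div, abs_of_pos hδ0, div_lt_one hδ0] at h1 h2
    set L := (m 0 : ℝ) * p + m 1 * q - (n 0 * p + n 1 * q) with hL
    set M := (m 0 : ℝ) * r + m 1 * t - (n 0 * r + n 1 * t) with hM
    have hcomb (x y : ℝ) (hxy : |x| + |y| ≤ R) : |L * x - M * y| ≤ δ * R := by
      refine (abs_sub _ _).trans ?_
      rw [abs_mul, abs_mul]
      nlinarith [abs_nonneg x, abs_nonneg y]
    have e0 : m 0 - n 0 = 0 := by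
      refine hzero _ ?_
      rw [← abs_mul]
      have : ((m 0 - n 0 : ℤ) : ℝ) * D = L * t - M * q := by push_cast; ring
      rw [this]
      exact hcomb _ _ (by linarith [abs_nonneg p, abs_nonneg r])
    have e1 : m 1 - n 1 = 0 := by
      refine hzero _ ?_
      rw [← abs_mul, ← abs_neg]
      have : -(((m 1 - n 1 : ℤ) : ℝ) * D) = L * r - M * p := by push_cast; ring
      rw [this]
      exact hcomb _ _ (by linarith [abs_nonneg q, abs_nonneg t])
    ext i
    fin_cases i
    · exact sub_eq_zero.1 e0
    · exact sub_eq_zero.1 e1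
  have hprod : Summable fun n : ℤ × ℤ =>
      (1 + |(n.1 : ℝ)|) ^ (-σ) * (1 + |(n.2 : ℝ)|) ^ (-σ) :=
    (summable_int_one_add_abs_rpow hσ).mul_of_nonneg (summable_int_one_add_abs_rpow hσ)
      (fun _ => by positivity) (fun _ => by positivity)
  set K := 2 + 1 / δ with hK
  have hround (x : ℝ) : (1 + |x|) ^ (-σ) ≤ K ^ σ * (1 + |(⌊x / δ⌋ : ℝ)|) ^ (-σ) := by
    have hfl : |(⌊x / δ⌋ : ℝ)| ≤ |x| / δ + 1 := by
      have h1 : |(⌊x / δ⌋ : ℝ) - x / δ| ≤ 1 := by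
        rw [abs_le]
        constructor <;> linarith [Int.floor_le (x / δ), Int.lt_floor_add_one (x / δ)]
      have h2 := abs_sub_abs_le_abs_sub (⌊x / δ⌋ : ℝ) (x / δ)
      rw [abs_div x, abs_of_pos hδ0] at h2
      linarith
    have hle : 1 + |(⌊x / δ⌋ : ℝ)| ≤ K * (1 + |x|) := by
      have : K * (1 + |x|) = |x| / δ + 2 + (2 * |x| + 1 / δ) := by rw [hK]; ring
      have : 0 ≤ 2 * |x| + 1 / δ := by positivity
      linarith
    have hK0 : 0 < K := by positivity
    calc (1 + |x|) ^ (-σ) = K ^ σ * (K * (1 + |x|)) ^ (-σ) := by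
          rw [Real.mul_rpow hK0.le (by positivity), ← mul_assoc, ← Real.rpow_add hK0]
          simp
      _ ≤ _ := by
          gcongr ?_ * ?_
          exact Real.rpow_le_rpow_of_nonpos (by positivity) hle (by linarith)
  refine Summable.of_nonneg_of_le (fun _ => by positivity) (fun m => ?_)
    ((hprod.comp_injective hφ).mul_left (K ^ σ * K ^ σ))
  refine (mul_le_mul (hround _) (hround _) (by positivity) (by positivity)).trans (le_of_eq ?_)
  simp only [φ, Function.comp_apply]
  ring

/-- For `1 ≤ a ≤ b ≤ 2c` the weight `a⁻ᵖ b⁻ᵠ c⁻ʳ` is at most of the order `a⁻ᵖ b⁻⁽ᵠ⁺ʳ⁾`, and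
part of the large decay in `b` can be spent on making up for a missing decay in `a`. -/
theorem rpow_mul_rpow_mul_rpow_le {a b c p q r σ : ℝ} (ha : 1 ≤ a) (hab : a ≤ b)
    (hbc : b ≤ 2 * c) (hr : 0 ≤ r) (h1 : σ ≤ q + r) (h2 : 2 * σ ≤ p + q + r) :
    a ^ (-p) * b ^ (-q) * c ^ (-r) ≤ 2 ^ r * (a ^ (-σ) * b ^ (-σ)) := by
  have ha0 : 0 < a := by linarith
  have hb0 : 0 < b := by linarith
  have hc0 : 0 < c := by linarith
  have hc : c ^ (-r) ≤ 2 ^ r * b ^ (-r) := by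
    calc c ^ (-r) = 2 ^ r * (2 * c) ^ (-r) := by
          rw [Real.mul_rpow (by norm_num) hc0.le, ← mul_assoc, ← Real.rpow_add (by norm_num)]
          simp
      _ ≤ _ := by
          gcongr ?_ * ?_
          exact Real.rpow_le_rpow_of_nonpos hb0 hbc (by linarith)
  have hshift : a ^ (σ - p) ≤ b ^ (q + r - σ) := by
    rcases le_total (σ - p) 0 with h | h
    · exact (Real.rpow_le_one_of_one_le_of_nonpos ha h).trans
        (Real.one_le_rpow (ha.trans hab) (by linarith))
    · exact (Real.rpow_le_rpow ha0.le hab h).trans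
        (Real.rpow_le_rpow_of_exponent_le (ha.trans hab) (by linarith))
  calc a ^ (-p) * b ^ (-q) * c ^ (-r) ≤ a ^ (-p) * b ^ (-q) * (2 ^ r * b ^ (-r)) := by gcongr
    _ = 2 ^ r * (a ^ (-σ) * b ^ (-(q + r)) * a ^ (σ - p)) := by
        rw [show -p = -σ + (σ - p) by ring, show -(q + r) = -q + -r by ring,
          Real.rpow_add ha0, Real.rpow_add hb0]
        ring
    _ ≤ 2 ^ r * (a ^ (-σ) * b ^ (-(q + r)) * b ^ (q + r - σ)) := by gcongr
    _ = 2 ^ r * (a ^ (-σ) * b ^ (-σ)) := by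
        rw [mul_assoc (a ^ (-σ)), ← Real.rpow_add hb0]
        ring_nf

/-- The three hypotheses on `a, b, c` are the triangle inequalities for `a - 1, b - 1, c - 1`. They
make the two larger of the three numbers comparable up to a factor `2`. -/
theorem rpow_mul_rpow_mul_rpow_le_sum {a b c p q r σ : ℝ} (ha : 1 ≤ a) (hb : 1 ≤ b) (hc : 1 ≤ c)
    (hab : a ≤ b + c - 1) (hbc : b ≤ a + c - 1) (hca : c ≤ a + b - 1)
    (hp : 0 ≤ p) (hq : 0 ≤ q) (hr : 0 ≤ r)
    (hpq : σ ≤ p + q) (hqr : σ ≤ q + r) (hpr : σ ≤ p + r) (h2 : 2 * σ ≤ p + q + r) :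
    a ^ (-p) * b ^ (-q) * c ^ (-r) ≤
      2 ^ (p + q + r) *
        (a ^ (-σ) * b ^ (-σ) + b ^ (-σ) * c ^ (-σ) + a ^ (-σ) * c ^ (-σ)) := by
  have hA : 0 ≤ a ^ (-σ) := by positivity
  have hB : 0 ≤ b ^ (-σ) := by positivity
  have hC : 0 ≤ c ^ (-σ) := by positivity
  have hpow (t : ℝ) (ht : t ≤ p + q + r) {x y : ℝ} (hx : 0 ≤ x) (hxy : x ≤ y) :
      2 ^ t * x ≤ 2 ^ (p + q + r) * y := by
    gcongr
    norm_num
  by_cases hmina : a ≤ b ∧ a ≤ c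
  · refine (rpow_mul_rpow_mul_rpow_le ha hmina.1 (by linarith) hr hqr h2).trans
      (hpow _ (by linarith) (by positivity) ?_)
    nlinarith [mul_nonneg hB hC, mul_nonneg hA hC]
  by_cases hminb : b ≤ c
  · have hba : b ≤ a := by
      by_contra hcon
      exact hmina ⟨by linarith, by linarith⟩
    have h := rpow_mul_rpow_mul_rpow_le (p := q) (q := r) (r := p) hb hminb (c := a)
      (by linarith) hp (σ := σ) (by linarith) (by linarith)
    refine (le_of_eq (by ring)).trans (h.trans (hpow _ (by linarith) (by positivity) ?_))
    nlinarith [mul_nonneg hA hB, mul_nonneg hA hC]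
  · have hca' : c ≤ a := by
      by_contra hcon
      exact hmina ⟨by linarith, by linarith⟩
    have h := rpow_mul_rpow_mul_rpow_le (p := r) (q := p) (r := q) hc hca' (c := b)
      (by linarith) hq (σ := σ) (by linarith) (by linarith)
    refine (le_of_eq (by ring)).trans (h.trans (hpow _ (by linarith) (by positivity) ?_))
    nlinarith [mul_nonneg hA hB, mul_nonneg hB hC]

/-! ### Riesz bases of integer translates -/

/-- A domination of `|G|²` on the cells by a convergent series makes `G` square integrable: this
is the case of the constant trigonometric polynomial. -/
theorem memLp_two_of_unitCell_bound {G : Plane → ℂ} (hG : Measurable G)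
    {V : (Fin 2 → ℤ) → ℝ} (hV : Summable V)
    (hGV : ∀ m, ∀ ξ ∈ unitCell m, ‖G ξ‖ ^ 2 ≤ V m) : MemLp G 2 volume := by
  have hW : ∀ m, ∀ ξ ∈ unitCell m, ‖G ξ‖ₑ ^ 2 ≤ ENNReal.ofReal (V m) := fun m ξ hξ => by
    rw [← ofReal_norm, ← ENNReal.ofReal_pow (norm_nonneg _)]
    exact ENNReal.ofReal_le_ofReal (hGV m ξ hξ)
  have h := lintegral_enorm_sq_mul_le hW {0} fun _ => 1
  have hone (ξ : Plane) : latticeChar 0 ξ = 1 := by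
    simp [latticeChar, UnitAddTorus.mFourier_zero]
  refine ⟨hG.aestronglyMeasurable, ?_⟩
  rw [eLpNorm_lt_top_iff_lintegral_rpow_enorm_lt_top (by norm_num) (by norm_num)]
  simp only [Finset.sum_singleton, neg_zero, hone, one_mul] at h
  simp only [ENNReal.toReal_ofNat, ENNReal.rpow_ofNat]
  exact h.trans_lt (ENNReal.mul_lt_top hV.tsum_ofReal_lt_top ENNReal.ofReal_lt_top)

/-- If `|B̂|²` is bounded below on the central cell and dominated on the cells by a convergent
series, then the integer translates of `B` form a Riesz basis of the space that they generate. -/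
theorem isRieszBasis_latticeTranslate {B : PlaneL2} {G : Plane → ℂ}
    (hBG : ⇑(𝓕 B : PlaneL2) =ᵐ[volume] G) {c : ℝ} (hc : 0 < c)
    (hcG : ∀ ξ ∈ unitCell 0, c ≤ ‖G ξ‖ ^ 2) {V : (Fin 2 → ℤ) → ℝ} (hV : Summable V)
    (hGV : ∀ m, ∀ ξ ∈ unitCell m, ‖G ξ‖ ^ 2 ≤ V m) :
    IsRieszBasis (latticeTranslate B) (shiftSpace B) := by
  have hV0 (m : Fin 2 → ℤ) : 0 ≤ V m := by
    have hm : latticePoint m ∈ unitCell m := fun i => by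
      simp only [latticePoint]
      constructor <;> linarith
    exact (sq_nonneg _).trans (hGV m _ hm)
  have hsum0 : 0 ≤ ∑' m, V m := tsum_nonneg hV0
  have hlow (s : Finset (Fin 2 → ℤ)) (a : (Fin 2 → ℤ) → ℂ) :
      c * ∑ k ∈ s, ‖a k‖ ^ 2 ≤ ‖∑ k ∈ s, a k • latticeTranslate B k‖ ^ 2 := by
    have h : ENNReal.ofReal c * ENNReal.ofReal (∑ k ∈ s, ‖a k‖ ^ 2) ≤ _ :=
      le_lintegral_enorm_sq_mul (G := G) (fun ξ hξ => by
        rw [← ofReal_norm, ← ENNReal.ofReal_pow (norm_nonneg _)]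
        exact ENNReal.ofReal_le_ofReal (hcG ξ hξ)) s a
    rw [← norm_sum_latticeTranslate_eq hBG, ← ENNReal.ofReal_mul hc.le] at h
    exact (ENNReal.ofReal_le_ofReal_iff (by positivity)).1 h
  have hup (s : Finset (Fin 2 → ℤ)) (a : (Fin 2 → ℤ) → ℂ) :
      ‖∑ k ∈ s, a k • latticeTranslate B k‖ ^ 2 ≤ (∑' m, V m + 1) * ∑ k ∈ s, ‖a k‖ ^ 2 := by
    have h := lintegral_enorm_sq_mul_le (G := G) (W := fun m => ENNReal.ofReal (V m))
      (fun m ξ hξ => by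
        rw [← ofReal_norm, ← ENNReal.ofReal_pow (norm_nonneg _)]
        exact ENNReal.ofReal_le_ofReal (hGV m ξ hξ)) s a
    rw [← norm_sum_latticeTranslate_eq hBG, ← ENNReal.ofReal_tsum_of_nonneg hV0 hV,
      ← ENNReal.ofReal_mul hsum0] at h
    have hA : 0 ≤ ∑ k ∈ s, ‖a k‖ ^ 2 := by positivity
    have := (ENNReal.ofReal_le_ofReal_iff (by positivity)).1 h
    linarith
  -- The summand `1` only serves to make the upper constant visibly positive.
  refine ⟨?_, c, ∑' m, V m + 1, hc, by positivity, fun s a => ⟨hlow s a, hup s a⟩⟩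
  ext x
  exact (exists_lp_hasSum_iff_mem_closure_span hc (by positivity) hlow hup x).symm

/-- An `L²` function and a bounded function that agree almost everywhere define the same tempered
distribution. -/
theorem toTemperedDistribution_toLp_two_eq_top {G : Plane → ℂ} (h2 : MemLp G 2 volume)
    (htop : MemLp G ∞ volume) :
    Lp.toTemperedDistribution h2.toLp = Lp.toTemperedDistribution htop.toLp := by
  ext φ
  rw [Lp.toTemperedDistribution_apply, Lp.toTemperedDistribution_apply]
  refine integral_congr_ae ?_
  filter_upwards [h2.coeFn_toLp, htop.coeFn_toLp] with ξ e1 e2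
  rw [e1, e2]

/-! ### The hex spline -/

theorem inner_two_pi_smul (ξ x : Plane) :
    inner ℝ ((2 * Real.pi) • ξ) x = 2 * Real.pi * (ξ 0 * x 0 + ξ 1 * x 1) := by
  rw [real_inner_smul_left]
  simp [PiLp.inner_apply, Fin.sum_univ_two, mul_comm]

theorem abs_sub_linearForm_le {ξ : Plane} {m : Fin 2 → ℤ} (hξ : ξ ∈ unitCell m) (x : Plane) :
    |ξ 0 * x 0 + ξ 1 * x 1 - (m 0 * x 0 + m 1 * x 1)| ≤ (|x 0| + |x 1|) / 2 := by
  have hi (i : Fin 2) : |ξ i - m i| ≤ 1 / 2 := by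
    have h := hξ i
    rw [abs_le]
    constructor <;> linarith [h.1, h.2]
  calc |ξ 0 * x 0 + ξ 1 * x 1 - (m 0 * x 0 + m 1 * x 1)|
      = |(ξ 0 - m 0) * x 0 + (ξ 1 - m 1) * x 1| := by ring_nf
    _ ≤ |ξ 0 - m 0| * |x 0| + |ξ 1 - m 1| * |x 1| := by
        rw [← abs_mul, ← abs_mul]
        exact abs_add_le _ _
    _ ≤ 1 / 2 * |x 0| + 1 / 2 * |x 1| := by
        gcongr
        exacts [hi 0, hi 1]
    _ = (|x 0| + |x 1|) / 2 := by ring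

theorem norm_bsplineFactor_inner_le {ξ x : Plane} {m : Fin 2 → ℤ} (hξ : ξ ∈ unitCell m)
    (hx : |x 0| + |x 1| ≤ 2) :
    ‖bsplineFactor (inner ℝ ((2 * Real.pi) • ξ) x)‖ ≤ 6 * (1 + |m 0 * x 0 + m 1 * x 1|)⁻¹ := by
  refine (norm_bsplineFactor_le _).trans ?_
  rw [inner_two_pi_smul, abs_mul, abs_of_pos Real.two_pi_pos, ← div_eq_mul_inv,
    div_le_div_iff₀ (by positivity) (by positivity)]
  have h1 := abs_sub_linearForm_le hξ x
  have h2 := abs_sub_abs_le_abs_sub ((m 0 : ℝ) * x 0 + m 1 * x 1) (ξ 0 * x 0 + ξ 1 * x 1)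
  rw [abs_sub_comm] at h2
  have h3 := abs_nonneg (ξ 0 * x 0 + ξ 1 * x 1)
  nlinarith [Real.pi_gt_three]

theorem norm_hexSplineHat_sq (x₁ x₂ : Plane) (α : Fin 3 → ℝ) (ω : Plane) :
    ‖hexSplineHat x₁ x₂ α ω‖ ^ 2 =
      ∏ j, ‖bsplineFactor (inner ℝ ω (hexKnots x₁ x₂ j))‖ ^ (2 * α j) := by
  rw [hexSplineHat, norm_prod, ← Finset.prod_pow]
  refine Finset.prod_congr rfl fun j _ => ?_
  rw [Complex.norm_cpow_real, mul_comm, Real.rpow_mul (norm_nonneg _), Real.rpow_two]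

/-- On the central cell `|⟨2πξ, xʲ⟩| ≤ π(|xʲ₁| + |xʲ₂|) < 2π`, so that `B̂_α(2πξ)` stays away from
the zeros of all three factors. -/
theorem exists_pos_le_norm_hexSplineHat_sq {x₁ x₂ : Plane} {α : Fin 3 → ℝ} (hα : ∀ j, 0 < α j)
    (hx : ∀ j, |hexKnots x₁ x₂ j 0| + |hexKnots x₁ x₂ j 1| < 2) :
    ∃ c > 0, ∀ ξ ∈ unitCell 0, c ≤ ‖hexSplineHat x₁ x₂ α ((2 * Real.pi) • ξ)‖ ^ 2 := by
  have hr (j : Fin 3) :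
      Real.pi * (|hexKnots x₁ x₂ j 0| + |hexKnots x₁ x₂ j 1|) < 2 * Real.pi := by
    nlinarith [Real.pi_pos, hx j]
  choose c hc hcle using fun j => exists_pos_le_norm_bsplineFactor (hr j)
  refine ⟨∏ j, c j ^ (2 * α j), Finset.prod_pos fun j _ => Real.rpow_pos_of_pos (hc j) _,
    fun ξ hξ => ?_⟩
  rw [norm_hexSplineHat_sq]
  refine Finset.prod_le_prod (fun j _ => (Real.rpow_pos_of_pos (hc j) _).le) fun j _ => ?_
  refine Real.rpow_le_rpow (hc j).le (hcle j _ ?_) (by linarith [hα j])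
  have h := abs_sub_linearForm_le hξ (hexKnots x₁ x₂ j)
  simp only [Pi.zero_apply, Int.cast_zero, zero_mul, add_zero, sub_zero] at h
  rw [inner_two_pi_smul, abs_mul, abs_of_pos Real.two_pi_pos]
  nlinarith [Real.pi_pos]

theorem det_ne_zero_of_linearIndependent {x₁ x₂ : Plane}
    (hind : LinearIndependent ℝ ![x₁, x₂]) : x₁ 0 * x₂ 1 - x₁ 1 * x₂ 0 ≠ 0 := by
  intro hdet
  rw [LinearIndependent.pair_iff] at hind
  have h0 := hind (x₂ 0) (-(x₁ 0)) (by ext i; fin_cases i <;> simp <;> linarith)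
  have h1 := hind (x₂ 1) (-(x₁ 1)) (by ext i; fin_cases i <;> simp <;> linarith)
  have h2 := hind 1 0 (by
    ext i
    fin_cases i
    · simpa using h0.2
    · simpa using h1.2)
  exact one_ne_zero h2.1

/-- The series of the products `∏ (1 + |⟨m, xʲ⟩|)^(-2αⱼ)` converges: each term is dominated by a
product of two factors of exponent `σ > 1`, one of which belongs to the smallest of the three
numbers `|⟨m, xʲ⟩|`. -/
theorem summable_prod_linearForm_rpow {x₁ x₂ : Plane} (hind : LinearIndependent ℝ ![x₁, x₂])
    {α : Fin 3 → ℝ} (hα : ∀ j, 0 < α j) (hsum : 1 < ∑ j, α j)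
    (hpair : ∀ i j, i ≠ j → 1 / 2 < α i + α j) :
    Summable fun m : Fin 2 → ℤ =>
      ∏ j, (1 + |m 0 * hexKnots x₁ x₂ j 0 + m 1 * hexKnots x₁ x₂ j 1|) ^ (-(2 * α j)) := by
  have hdet := det_ne_zero_of_linearIndependent hind
  have h01 := hpair 0 1 (by decide)
  have h12 := hpair 1 2 (by decide)
  have h02 := hpair 0 2 (by decide)
  rw [Fin.sum_univ_three] at hsum
  obtain ⟨σ, hσ, hσ'⟩ : ∃ σ, 1 < σ ∧ σ ≤ min (α 0 + α 1 + α 2)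
      (min (2 * (α 0 + α 1)) (min (2 * (α 1 + α 2)) (2 * (α 0 + α 2)))) :=
    ⟨_, by simp only [lt_min_iff]; refine ⟨?_, ?_, ?_, ?_⟩ <;> linarith, le_rfl⟩
  simp only [le_min_iff] at hσ'
  obtain ⟨hσs, hσ01, hσ12, hσ02⟩ := hσ'
  have hS (i j : Fin 3) (hij : hexKnots x₁ x₂ i 0 * hexKnots x₁ x₂ j 1 -
      hexKnots x₁ x₂ i 1 * hexKnots x₁ x₂ j 0 ≠ 0) := summable_linearForms_rpow hij hσ
  have S01 := hS 0 1 (by simpa [hexKnots] using hdet)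
  have S12 := hS 1 2 (by
    simp only [hexKnots, Matrix.cons_val, PiLp.neg_apply, PiLp.add_apply]
    exact fun h => hdet (by linarith))
  have S02 := hS 0 2 (by
    simp only [hexKnots, Matrix.cons_val, PiLp.neg_apply, PiLp.add_apply]
    exact fun h => hdet (by linarith))
  refine Summable.of_nonneg_of_le (fun m => by positivity) (fun m => ?_)
    (((S01.add S12).add S02).mul_left (2 ^ (2 * α 0 + 2 * α 1 + 2 * α 2)))
  rw [Fin.prod_univ_three]
  have hL2 : (m 0 : ℝ) * hexKnots x₁ x₂ 2 0 + m 1 * hexKnots x₁ x₂ 2 1 =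
      -((m 0 * hexKnots x₁ x₂ 0 0 + m 1 * hexKnots x₁ x₂ 0 1) +
        (m 0 * hexKnots x₁ x₂ 1 0 + m 1 * hexKnots x₁ x₂ 1 1)) := by
    simp only [hexKnots, Matrix.cons_val, PiLp.neg_apply, PiLp.add_apply]
    ring
  rw [hL2]
  generalize (m 0 : ℝ) * hexKnots x₁ x₂ 0 0 + m 1 * hexKnots x₁ x₂ 0 1 = u
  generalize (m 0 : ℝ) * hexKnots x₁ x₂ 1 0 + m 1 * hexKnots x₁ x₂ 1 1 = v
  rw [abs_neg]
  have t1 := abs_add_le u v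
  have t2 : |u| ≤ |v| + |u + v| := by
    have := abs_sub (u + v) v
    rw [add_sub_cancel_right] at this
    linarith
  have t3 : |v| ≤ |u| + |u + v| := by
    have := abs_sub (u + v) u
    rw [add_sub_cancel_left] at this
    linarith
  have n1 := abs_nonneg u
  have n2 := abs_nonneg v
  have n3 := abs_nonneg (u + v)
  apply rpow_mul_rpow_mul_rpow_le_sum <;> linarith [hα 0, hα 1, hα 2]

theorem norm_hexSplineHat_sq_le {x₁ x₂ : Plane} {α : Fin 3 → ℝ} (hα : ∀ j, 0 < α j)
    (hx : ∀ j, |hexKnots x₁ x₂ j 0| + |hexKnots x₁ x₂ j 1| < 2) (m : Fin 2 → ℤ) {ξ : Plane}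
    (hξ : ξ ∈ unitCell m) :
    ‖hexSplineHat x₁ x₂ α ((2 * Real.pi) • ξ)‖ ^ 2 ≤ (∏ j, (6 : ℝ) ^ (2 * α j)) *
      ∏ j, (1 + |m 0 * hexKnots x₁ x₂ j 0 + m 1 * hexKnots x₁ x₂ j 1|) ^ (-(2 * α j)) := by
  rw [norm_hexSplineHat_sq, ← Finset.prod_mul_distrib]
  refine Finset.prod_le_prod (fun j _ => by positivity) fun j _ => ?_
  rw [Real.rpow_neg (by positivity), ← Real.inv_rpow (by positivity),
    ← Real.mul_rpow (by norm_num) (by positivity)]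
  exact Real.rpow_le_rpow (norm_nonneg _) (norm_bsplineFactor_inner_le hξ (hx j).le)
    (by linarith [hα j])

theorem mainTheorem1 (x₁ x₂ : Plane) (hind : LinearIndependent ℝ ![x₁, x₂])
    (ϑ : Fin 3 → ℝ) (hϑ : ∀ j, ϑ j < 2)
    (h₁ : |x₁ 0| + |x₁ 1| ≤ ϑ 0)
    (h₂ : |x₂ 0| + |x₂ 1| ≤ ϑ 1)
    (h₃ : |(x₁ + x₂) 0| + |(x₁ + x₂) 1| ≤ ϑ 2)
    (hx₁ : x₁ 0 ≠ 0) (hx₂ : x₂ 0 ≠ 0)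
    (hirr₁ : Irrational (x₁ 1 / x₁ 0)) (hirr₂ : Irrational (x₂ 1 / x₂ 0))
    (α : Fin 3 → ℝ) (hα : ∀ j, 0 < α j)
    (hsum : 1 < ∑ j, α j)
    (hpair : ∀ i j, i ≠ j → 1 / 2 < α i + α j) :
    ∃ B : PlaneL2, Lp.toTemperedDistribution B = hexSpline x₁ x₂ α hα ∧
      IsRieszBasis (latticeTranslate B) (shiftSpace B) := by
  have hx (j : Fin 3) : |hexKnots x₁ x₂ j 0| + |hexKnots x₁ x₂ j 1| < 2 := by
    fin_cases j
    · exact h₁.trans_lt (hϑ 0)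
    · exact h₂.trans_lt (hϑ 1)
    · have h : |(-(x₁ + x₂)) 0| + |(-(x₁ + x₂)) 1| < 2 := by
        rw [PiLp.neg_apply, PiLp.neg_apply, abs_neg, abs_neg]
        exact h₃.trans_lt (hϑ 2)
      exact h
  obtain ⟨c, hc, hlow⟩ := exists_pos_le_norm_hexSplineHat_sq hα hx
  have hV := (summable_prod_linearForm_rpow hind hα hsum hpair).mul_left (∏ j, (6 : ℝ) ^ (2 * α j))
  have hup := fun m ξ (hξ : ξ ∈ unitCell m) => norm_hexSplineHat_sq_le hα hx m hξ
  have hmeas : Measurable fun ξ : Plane => hexSplineHat x₁ x₂ α ((2 * Real.pi) • ξ) :=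
    (measurable_hexSplineHat x₁ x₂ α).comp (measurable_const_smul _)
  have hG := memLp_two_of_unitCell_bound hmeas hV hup
  refine ⟨𝓕⁻ hG.toLp, ?_, isRieszBasis_latticeTranslate ?_ hc hlow hV hup⟩
  · rw [hexSpline, ← toTemperedDistribution_toLp_two_eq_top hG,
      Lp.fourierInv_toTemperedDistribution_eq]
  · rw [FourierTransform.fourier_fourierInv_eq]
    exact hG.coeFn_toLp
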